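/- All graphs are finite and simple. For a graph $G$ with nonempty vertex set, let $\rho(G)=\max_{G'}|E(G')|/|V(G')|$ be its maximum density, the maximum being over all subgraphs $G'$ of $G$ with nonempty vertex set. For $k\in\mathbb N$, a random $k$-fold cover of $G$ is the random graph $H$ on $V(G)\times\{1,\dots,k\}$ obtained by fixing a linear order of $V(G)$, choosing for every edge $uv\in E(G)$ with $u<v$, independently and uniformly at random, a permutation $\sigma_{uv}$ of $\{1,\dots,k\}$, and joining $(u,i)$ to $(v,\sigma_{uv}(i))$ for every $i\in\{1,\dots,k\}$; there are no other edges. We say that $G$ is $k$-DP-colorable with probability $p$ if $p$ is the probability that $H$ has an independent set containing exactly one vertex from each list $L(v)=\{v\}\times\{1,\dots,k\}$, $v\in V(G)$. **Theorem.** For all real $\varepsilon>0$ and $s\in[0,1/3)$ there is $n_0\in\mathbb N$ such that the following holds. Let $G$ be a graph with $n\ge n_0$ vertices such that $\rho(G)\ge n^{1-s}$, and let $k\in\mathbb N$ satisfy $$k\ \ge\ (1+\varepsilon)\left(1+\frac{s}{1-2s}\right)\frac{\rho(G)}{\ln\rho(G)}.$$ Then $G$ is $k$-DP-colorable with probability at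 least $1-\varepsilon$. -/

import Mathlib

namespace DPColoring

/-- The density `|E(H)| / |V(H)|` of a subgraph `H` of a graph. -/
noncomputable def density {V : Type*} {G : SimpleGraph V} (H : G.Subgraph) : ℝ :=
  (H.edgeSet.ncard : ℝ) / (H.verts.ncard : ℝ)

/-- The maximum density `ρ(G)`: the maximum of the densities of the nonempty subgraphs of `G`. -/
noncomputable def maxDensity {V : Type*} (G : SimpleGraph V) : ℝ :=
  sSup {d : ℝ | ∃ H : G.Subgraph, H.verts.Nonempty ∧ d = density H}

/-- For a finite nonempty graph the supremum in `maxDensity` is a maximum. -/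
theorem isGreatest_maxDensity {V : Type*} [Finite V] [Nonempty V] (G : SimpleGraph V) :
    IsGreatest {d : ℝ | ∃ H : G.Subgraph, H.verts.Nonempty ∧ d = density H} (maxDensity G) := by
  have hfin : {d : ℝ | ∃ H : G.Subgraph, H.verts.Nonempty ∧ d = density H}.Finite := by
    refine (Set.finite_range (fun H : G.Subgraph => density H)).subset ?_
    rintro d ⟨H, -, rfl⟩
    exact ⟨H, rfl⟩
  have hne : {d : ℝ | ∃ H : G.Subgraph, H.verts.Nonempty ∧ d = density H}.Nonempty :=
    ⟨_, ⊤, Set.univ_nonempty, rfl⟩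
  exact ⟨hne.csSup_mem hfin, fun d hd => le_csSup hfin.bddAbove hd⟩

/-- A DP-cover `(L, H)` of a graph `G`, where the graph `H` has vertex set `W`. -/
structure Cover {V : Type*} (G : SimpleGraph V) (W : Type*) where
  /-- the list `L(v)` of each vertex `v` of `G` -/
  list : V → Set W
  /-- the cover graph `H` -/
  graph : SimpleGraph W
  /-- the lists partition the vertex set of `H` (for a `0`-fold cover all lists are empty) -/
  partition : ∀ x : W, ∃! v : V, x ∈ list v
  /-- every list is an independent set of `H` -/
  indep : ∀ v : V, graph.IsIndepSet (list v)
  /-- between the lists of adjacent vertices, the edges of `H` form a matching; the condition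
  is applied to `(u, v)` and to `(v, u)` -/
  matching : ∀ u v : V, G.Adj u v → ∀ x ∈ list u, ∀ y ∈ list v, ∀ z ∈ list v,
    graph.Adj x y → graph.Adj x z → y = z
  /-- every edge of `H` lies between the lists of two adjacent vertices -/
  edges : ∀ x y : W, graph.Adj x y → ∃ u v : V, G.Adj u v ∧ x ∈ list u ∧ y ∈ list v

/-- A transversal: a set of vertices of `H` with exactly one vertex in each list. -/
def Cover.IsTransversal {V W : Type*} {G : SimpleGraph V} (C : Cover G W) (T : Set W) : Prop :=
  ∀ v : V, ∃! x : W, x ∈ T ∧ x ∈ C.list v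

/-- `G` is colorable from the cover `(L, H)`: there is an independent transversal. -/
def Cover.Colorable {V W : Type*} {G : SimpleGraph V} (C : Cover G W) : Prop :=
  ∃ T : Set W, C.IsTransversal T ∧ C.graph.IsIndepSet T

/-- The graph `H_σ` on `V(G) × [k]`, for a family `σ` of permutations of `[k]` indexed by the edges
of `G`: for each edge `uv` of `G` with `u < v`, the vertex `(u, i)` is joined to
`(v, σ_{uv}(i))`. -/
def permGraph {V : Type*} [LinearOrder V] (G : SimpleGraph V) (k : ℕ)
    (σ : G.edgeSet → Equiv.Perm (Fin k)) : SimpleGraph (V × Fin k) where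
  Adj x y := ∃ e : G.edgeSet, e.1 = s(x.1, y.1) ∧
    ((x.1 < y.1 ∧ σ e x.2 = y.2) ∨ (y.1 < x.1 ∧ σ e y.2 = x.2))
  symm := ⟨by
    rintro x y ⟨e, he, h⟩
    exact ⟨e, he.trans Sym2.eq_swap, h.symm⟩⟩
  loopless := ⟨by
    rintro x ⟨e, -, h | h⟩
    · exact lt_irrefl _ h.1
    · exact lt_irrefl _ h.1⟩

/-- The full `k`-fold cover `(L, H_σ)` of `G`, where `L(v) = {(v, i) : i ∈ [k]}`. -/
def permCover {V : Type*} [LinearOrder V] (G : SimpleGraph V) (k : ℕ)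
    (σ : G.edgeSet → Equiv.Perm (Fin k)) : Cover G (V × Fin k) where
  list v := {x | x.1 = v}
  graph := permGraph G k σ
  partition x := ⟨x.1, rfl, fun _ h => h.symm⟩
  indep := by
    rintro v x hx y hy - ⟨e, -, h⟩
    have hxy : x.1 = y.1 := Eq.trans hx (Eq.symm hy)
    rcases h with h | h
    · exact h.1.ne hxy
    · exact h.1.ne hxy.symm
  matching := by
    rintro u v - x hx y hy z hz ⟨e, he, h⟩ ⟨f, hf, h'⟩
    have hyz : y.1 = z.1 := Eq.trans hy (Eq.symm hz)
    have hef : e = f := Subtype.ext (by rw [he, hf, hyz])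
    subst hef
    refine Prod.ext hyz ?_
    rcases h with ⟨h1, h2⟩ | ⟨h1, h2⟩ <;> rcases h' with ⟨h3, h4⟩ | ⟨h3, h4⟩
    · exact h2.symm.trans h4
    · exact absurd (hyz ▸ h3) h1.not_gt
    · exact absurd (hyz ▸ h3) h1.not_gt
    · exact (σ e).injective (h2.trans h4.symm)
  edges := by
    rintro x y ⟨e, he, -⟩
    refine ⟨x.1, y.1, ?_, rfl, rfl⟩
    rw [← SimpleGraph.mem_edgeSet, ← he]
    exact e.2

/-- The random `k`-fold cover of a finite graph `G`: the law of the cover `(L, H_σ)`, where the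
family `σ` of permutations of `[k]`, one for each edge of `G`, is uniformly distributed. -/
noncomputable def randomCover {V : Type*} [Finite V] [LinearOrder V] (G : SimpleGraph V) (k : ℕ) :
    PMF (Cover G (V × Fin k)) :=
  letI : Fintype (G.edgeSet → Equiv.Perm (Fin k)) := Fintype.ofFinite _
  (PMF.uniformOfFintype (G.edgeSet → Equiv.Perm (Fin k))).map (permCover G k)

/-- The probability that `G` is colorable from its random `k`-fold cover, i.e. the probability with
which `G` is `k`-DP-colorable. -/
noncomputable def colorableProb {V : Type*} [Finite V] [LinearOrder V] (G : SimpleGraph V)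
    (k : ℕ) : ℝ :=
  ((randomCover G k).toOuterMeasure {C | C.Colorable}).toReal

end DPColoring

/-!
The proof is the second moment method applied to the number `X` of independent transversals of the
random cover, counted as colorings `f : V → Fin k` with `σ e (f e.inf) ≠ f e.sup` on every edge `e`.

Write `n` and `m` for the numbers of vertices and edges and `ρ` for the maximum density. The mean of
`X` is `k ^ n * (1 - 1/k) ^ m` (`sum_card_isProper`). For a pair of colorings `f`, `g` with agreement
set `S`, the probability that both respect a given edge exceeds the product of the two probabilities
by a factor of at most `1 + 1/(k-1)^3`, except on the edges inside `S`, where the two events coincide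
and the factor is `1 + 1/(k-1)` (`card_perm_apply_ne_apply_ne_le`). Hence `E[X ^ 2] / E[X] ^ 2` is at most
`(1 + 1/(k-1)^3) ^ m`, which tends to `1`, times the average of `exp (e(S) / (k-1))` over all pairs
(`sum_card_isProper_sq_le`).

The number `e(S)` of edges inside `S` is at most `min (ρ |S|) (|S|^2 / 2)`. Sets with
`|S| ≤ ρ ^ b`, where `b < 1/2`, contribute a factor close to `1`, since `|S|^2 / k` is small. A set
of size `i` is contained in the agreement set with probability `k ^ (-i)`, so that by a union bound
(`sum_agreeSet_le`) the larger sets of size `i` contribute at most the `i`-th power of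
`(e n / (i k)) exp (min (ρ, i/2) / (k-1))`. This base tends to `0` uniformly in `i > ρ ^ b`: by
convexity it suffices to look at `i = ρ ^ b`, where `s < 1/3` is needed, and at `i = 2ρ`, where the
constant in the lower bound on `k` is exactly what is needed (`eventually_moment_estimates`).
Therefore `E[X ^ 2] ≤ (1 + o(1)) E[X] ^ 2`, and Cauchy–Schwarz gives `P(X > 0) ≥ 1 - o(1)`
(`inv_le_colorableProb`).
-/

namespace DPColoring

open Finset

/-! ### Random permutations -/

section PermCount

variable {α : Type*} [Fintype α] [DecidableEq α]

theorem card_perm_apply_eq (a b : α) :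
    (#{π : Equiv.Perm α | π a = b} : ℝ) = (Fintype.card α).factorial / Fintype.card α := by
  -- composing with a transposition shows that all values at `a` are equally likely
  have hconst : ∀ b' ∈ (univ : Finset α),
      #{π : Equiv.Perm α | π a = b'} = #{π : Equiv.Perm α | π a = b} := fun b' _ =>
    card_equiv (Equiv.mulLeft (Equiv.swap b' b)) fun π => by
      simp [Equiv.swap_apply_eq_iff]
  have h := card_eq_sum_card_fiberwise (f := fun π : Equiv.Perm α => π a)
    (s := univ) (t := univ) (by simp)
  rw [card_univ, Fintype.card_perm, sum_congr rfl hconst, sum_const, card_univ, smul_eq_mul] at h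
  have hα : (Fintype.card α : ℝ) ≠ 0 := by
    have : Nonempty α := ⟨a⟩
    exact_mod_cast Fintype.card_ne_zero
  rw [eq_div_iff hα, h]
  push_cast
  ring

theorem card_perm_apply_eq_apply_eq {a b c d : α} (hac : a ≠ c) (hbd : b ≠ d) :
    (#{π : Equiv.Perm α | π a = b ∧ π c = d} : ℝ) =
      (Fintype.card α).factorial / (Fintype.card α * (Fintype.card α - 1)) := by
  -- given `π a = b`, all values at `c` other than `b` are equally likely
  have hconst : ∀ d' ∈ univ.erase b,
      #{π ∈ ({π : Equiv.Perm α | π a = b} : Finset _) | π c = d'} =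
        #{π : Equiv.Perm α | π a = b ∧ π c = d} := by
    intro d' hd'
    rw [filter_filter]
    refine card_equiv (Equiv.mulLeft (Equiv.swap d' d)) fun π => ?_
    have : Equiv.swap d' d b = b := Equiv.swap_apply_of_ne_of_ne (ne_of_mem_erase hd').symm hbd
    simp [Equiv.swap_apply_eq_iff, this]
  have h := card_eq_sum_card_fiberwise (f := fun π : Equiv.Perm α => π c)
    (s := {π : Equiv.Perm α | π a = b}) (t := univ.erase b) (by
      intro π hπ
      simp only [coe_filter, mem_univ, true_and, Set.mem_ofPred_eq] at hπ
      simp only [coe_erase, coe_univ, Set.mem_sdiff, Set.mem_univ, true_and,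
        Set.mem_singleton_iff, ← hπ]
      exact fun h => hac (π.injective h).symm)
  rw [sum_congr rfl hconst, sum_const, card_erase_of_mem (mem_univ _), card_univ,
    smul_eq_mul] at h
  have hα : 1 < Fintype.card α := Fintype.one_lt_card_iff.2 ⟨a, c, hac⟩
  have h' := card_perm_apply_eq a b
  rw [h, Nat.cast_mul, Nat.cast_sub hα.le, Nat.cast_one] at h'
  have h1 : (1 : ℝ) < Fintype.card α := by exact_mod_cast hα
  rw [eq_div_iff (by nlinarith)]
  rw [eq_div_iff (by linarith)] at h'
  linarith

theorem card_perm_apply_ne (a b : α) :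
    (#{π : Equiv.Perm α | π a ≠ b} : ℝ) =
      (Fintype.card α).factorial * (1 - 1 / Fintype.card α) := by
  have h := card_filter_add_card_filter_not (s := (univ : Finset (Equiv.Perm α))) fun π => π a = b
  rw [card_univ, Fintype.card_perm] at h
  have h' : (#{π : Equiv.Perm α | π a = b} : ℝ) + #{π : Equiv.Perm α | ¬ π a = b} =
      (Fintype.card α).factorial := by exact_mod_cast h
  rw [card_perm_apply_eq] at h'
  simp only [ne_eq]
  linear_combination h'

/-- For a uniformly random permutation `π` of `k` points, the probability of `π a ≠ b ∧ π c ≠ d`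
exceeds `(1 - 1/k) ^ 2` at most slightly unless the two events coincide. The error `1/(k-1)^3` comes
from the case `a ≠ c`, `b ≠ d`; if exactly one of `a = c`, `b = d` holds, the events `π a = b` and
`π c = d` exclude each other. -/
theorem card_perm_apply_ne_apply_ne_le (hα : 1 < Fintype.card α) (a b c d : α) :
    (#{π : Equiv.Perm α | π a ≠ b ∧ π c ≠ d} : ℝ) ≤
      (Fintype.card α).factorial * (1 - 1 / Fintype.card α) ^ 2 *
        (1 + 1 / ((Fintype.card α : ℝ) - 1) ^ 3) *
          (if a = c ∧ b = d then 1 + 1 / ((Fintype.card α : ℝ) - 1) else 1) := by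
  have hk : (1 : ℝ) < Fintype.card α := by exact_mod_cast hα
  have hincl : (#{π : Equiv.Perm α | π a ≠ b ∧ π c ≠ d} : ℝ) =
      (Fintype.card α).factorial - #{π : Equiv.Perm α | π a = b} -
        #{π : Equiv.Perm α | π c = d} + #{π : Equiv.Perm α | π a = b ∧ π c = d} := by
    have h1 := card_filter_add_card_filter_not (s := (univ : Finset (Equiv.Perm α)))
      fun π => π a = b ∨ π c = d
    have h2 := card_union_add_card_inter ({π : Equiv.Perm α | π a = b} : Finset _)
      {π : Equiv.Perm α | π c = d}
    rw [← filter_or, ← filter_and] at h2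
    rw [card_univ, Fintype.card_perm] at h1
    simp only [not_or] at h1
    rify at h1 h2
    simp only [ne_eq]
    linarith
  rw [hincl, card_perm_apply_eq, card_perm_apply_eq]
  have hfac : (0 : ℝ) < (Fintype.card α).factorial := by positivity
  set k : ℝ := (Fintype.card α : ℝ)
  set F : ℝ := ((Fintype.card α).factorial : ℝ)
  have hk1 : 0 < k - 1 := by linarith
  have hk0 : 0 < k := by linarith
  have hone : 0 ≤ 1 / (k - 1) ^ 3 := by positivity
  by_cases hac : a = c
  · subst hac
    by_cases hbd : b = d
    · subst hbd
      simp only [and_self, if_true]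
      rw [card_perm_apply_eq]
      have : F - F / k - F / k + F / k = F * (1 - 1 / k) ^ 2 * (1 + 1 / (k - 1)) := by
        field_simp
        ring
      change F - F / k - F / k + F / k ≤ _
      rw [this]
      have h3 : 0 ≤ F * (1 - 1 / k) ^ 2 * (1 + 1 / (k - 1)) := by positivity
      nlinarith [mul_nonneg h3 hone]
    · have h0 : #{π : Equiv.Perm α | π a = b ∧ π a = d} = 0 := by
        rw [card_eq_zero, filter_eq_empty_iff]
        rintro π - ⟨h, h'⟩
        exact hbd (h.symm.trans h')
      rw [h0, if_neg (fun h => hbd h.2)]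
      have h3 : 0 ≤ F * (1 - 1 / k) ^ 2 * (1 / (k - 1) ^ 3) := by positivity
      have h4 : F - F / k - F / k ≤ F * (1 - 1 / k) ^ 2 := by
        have : 0 ≤ F * (1 / k) ^ 2 := by positivity
        have e : F / k = F * (1 / k) := by ring
        rw [e]
        nlinarith
      push_cast
      linarith
  · rw [if_neg (fun h => hac h.1)]
    by_cases hbd : b = d
    · subst hbd
      have h0 : #{π : Equiv.Perm α | π a = b ∧ π c = b} = 0 := by
        rw [card_eq_zero, filter_eq_empty_iff]
        rintro π - ⟨h, h'⟩
        exact hac (π.injective (h.trans h'.symm))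
      rw [h0]
      have h3 : 0 ≤ F * (1 - 1 / k) ^ 2 * (1 / (k - 1) ^ 3) := by positivity
      have h4 : F - F / k - F / k ≤ F * (1 - 1 / k) ^ 2 := by
        have : 0 ≤ F * (1 / k) ^ 2 := by positivity
        have e : F / k = F * (1 / k) := by ring
        rw [e]
        nlinarith
      push_cast
      linarith
    · rw [card_perm_apply_eq_apply_eq hac hbd]
      refine le_of_eq ?_
      change F - F / k - F / k + F / (k * (k - 1)) = _
      field_simp
      ring

end PermCount

/-! ### Independent transversals and the second moment method -/

variable {V : Type*} [LinearOrder V] {G : SimpleGraph V} {k : ℕ}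

/-- The coloring `f` is proper for `σ` if its graph, a transversal of the cover `H_σ`, is
independent. The endpoints of an edge `e` are addressed in increasing order as `e.inf` and `e.sup`. -/
def IsProper (σ : G.edgeSet → Equiv.Perm (Fin k)) (f : V → Fin k) : Prop :=
  ∀ e : G.edgeSet, σ e (f e.1.inf) ≠ f e.1.sup

theorem IsProper.colorable {σ : G.edgeSet → Equiv.Perm (Fin k)} {f : V → Fin k}
    (hf : IsProper σ f) : (permCover G k σ).Colorable := by
  refine ⟨{x | f x.1 = x.2}, fun v => ⟨(v, f v), ⟨rfl, rfl⟩, ?_⟩, ?_⟩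
  · rintro ⟨w, i⟩ ⟨h, h'⟩
    obtain rfl : w = v := h'
    exact Prod.ext rfl (Eq.symm h)
  · rintro ⟨u, i⟩ hx ⟨v, j⟩ hy - ⟨e, he, h⟩
    obtain rfl : f u = i := hx
    obtain rfl : f v = j := hy
    have := hf e
    rw [he] at this
    rcases h with ⟨h, h'⟩ | ⟨h, h'⟩
    · simp only [Sym2.inf_mk, Sym2.sup_mk, inf_eq_left.2 h.le, sup_eq_right.2 h.le] at this
      exact this h'
    · simp only [Sym2.inf_mk, Sym2.sup_mk, inf_eq_right.2 h.le, sup_eq_left.2 h.le] at this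
      exact this h'

variable [Fintype V]

open Classical in
theorem colorableProb_eq :
    colorableProb G k =
      (#{σ : G.edgeSet → Equiv.Perm (Fin k) | (permCover G k σ).Colorable} : ℝ) /
        Fintype.card (G.edgeSet → Equiv.Perm (Fin k)) := by
  unfold colorableProb randomCover
  rw [PMF.toOuterMeasure_map_apply,
    @PMF.toOuterMeasure_uniformOfFintype_apply _ (Fintype.ofFinite _) _ _ (Fintype.ofFinite _),
    ENNReal.toReal_div, ENNReal.toReal_natCast, ENNReal.toReal_natCast, ← Fintype.card_subtype]
  congr 2
  · convert rfl
    exact Iff.rfl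
  · convert rfl

open Classical in
/-- The second moment method: by Cauchy–Schwarz, a bound on the second moment of the number of
independent transversals in terms of its squared mean bounds the colorability probability. -/
theorem inv_le_colorableProb {μ R : ℝ} (hμ : 0 < μ) (hR : 0 < R)
    (h₁ : (∑ σ : G.edgeSet → Equiv.Perm (Fin k), (#{f | IsProper σ f} : ℝ)) =
      Fintype.card (G.edgeSet → Equiv.Perm (Fin k)) * μ)
    (h₂ : (∑ σ : G.edgeSet → Equiv.Perm (Fin k), (#{f | IsProper σ f} : ℝ) ^ 2) ≤
      Fintype.card (G.edgeSet → Equiv.Perm (Fin k)) * (R * μ ^ 2)) :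
    R⁻¹ ≤ colorableProb G k := by
  set S : Finset (G.edgeSet → Equiv.Perm (Fin k)) := {σ | (permCover G k σ).Colorable}
  have hsub : (∑ σ : G.edgeSet → Equiv.Perm (Fin k), (#{f | IsProper σ f} : ℝ)) =
      ∑ σ ∈ S, (#{f | IsProper σ f} : ℝ) := by
    refine (sum_subset (subset_univ S) fun σ _ hσ => ?_).symm
    rw [Nat.cast_eq_zero, card_eq_zero, filter_eq_empty_iff]
    intro f _ hf
    exact hσ (mem_filter.2 ⟨mem_univ _, hf.colorable⟩)
  have hcs := sq_sum_le_card_mul_sum_sq (s := S) (f := fun σ => (#{f | IsProper σ f} : ℝ))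
  have hsq : ∑ σ ∈ S, (#{f | IsProper σ f} : ℝ) ^ 2 ≤
      ∑ σ : G.edgeSet → Equiv.Perm (Fin k), (#{f | IsProper σ f} : ℝ) ^ 2 :=
    sum_le_sum_of_subset_of_nonneg (subset_univ S) fun _ _ _ => by positivity
  rw [← hsub, h₁] at hcs
  rw [colorableProb_eq]
  have hN : (0 : ℝ) < Fintype.card (G.edgeSet → Equiv.Perm (Fin k)) := by
    exact_mod_cast Fintype.card_pos
  set N : ℝ := (Fintype.card (G.edgeSet → Equiv.Perm (Fin k)) : ℝ)
  have h3 : (N * μ) ^ 2 ≤ #S * (N * (R * μ ^ 2)) :=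
    hcs.trans (mul_le_mul_of_nonneg_left (hsq.trans h₂) (Nat.cast_nonneg _))
  rw [inv_eq_one_div, div_le_div_iff₀ hR hN, one_mul]
  have h4 : 0 < N * μ ^ 2 := by positivity
  refine le_of_mul_le_mul_right ?_ h4
  change N * (N * μ ^ 2) ≤ #S * R * (N * μ ^ 2)
  nlinarith

open Classical in
theorem sum_card_isProper :
    (∑ σ : G.edgeSet → Equiv.Perm (Fin k), (#{f | IsProper σ f} : ℝ)) =
      Fintype.card (G.edgeSet → Equiv.Perm (Fin k)) *
        ((k : ℝ) ^ Fintype.card V * (1 - 1 / (k : ℝ)) ^ Fintype.card G.edgeSet) := by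
  have hsw := sum_card_bipartiteAbove_eq_sum_card_bipartiteBelow
    (s := (univ : Finset (G.edgeSet → Equiv.Perm (Fin k)))) (t := (univ : Finset (V → Fin k)))
    (fun σ f => IsProper σ f)
  simp only [bipartiteAbove, bipartiteBelow] at hsw
  rw [← Nat.cast_sum, hsw, Nat.cast_sum]
  have hf : ∀ f : V → Fin k, (#{σ : G.edgeSet → Equiv.Perm (Fin k) | IsProper σ f} : ℝ) =
      ((k.factorial : ℝ) * (1 - 1 / (k : ℝ))) ^ Fintype.card G.edgeSet := by
    intro f
    have h : #{σ : G.edgeSet → Equiv.Perm (Fin k) | IsProper σ f} =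
        ∏ e : G.edgeSet, #{π : Equiv.Perm (Fin k) | π (f e.1.inf) ≠ f e.1.sup} := by
      rw [← Fintype.card_piFinset]
      congr 1
      ext σ
      simp [IsProper]
    rw [h, Nat.cast_prod]
    simp only [card_perm_apply_ne, Fintype.card_fin, prod_const, card_univ]
  simp only [hf, sum_const, card_univ, Fintype.card_fun, Fintype.card_fin, Fintype.card_perm,
    nsmul_eq_mul, Nat.cast_pow, mul_pow]
  ring

/-! ### The second moment in terms of agreement sets -/

/-- The set of vertices on which two colorings agree. -/
def agreeSet (f g : V → Fin k) : Finset V := {v | f v = g v}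

open Classical in
/-- The edges of `G` with both endpoints in `S`. -/
noncomputable def edgesIn (G : SimpleGraph V) (S : Finset V) : Finset G.edgeSet :=
  {e | e.1.inf ∈ S ∧ e.1.sup ∈ S}

open Classical in
/-- The second moment is a sum over pairs of colorings, and for each pair the edges carry independent
permutations. -/
theorem sum_card_isProper_sq_le (hk : 1 < k) :
    (∑ σ : G.edgeSet → Equiv.Perm (Fin k), (#{f | IsProper σ f} : ℝ) ^ 2) ≤
      Fintype.card (G.edgeSet → Equiv.Perm (Fin k)) *
        ((1 - 1 / (k : ℝ)) ^ 2 * (1 + 1 / ((k : ℝ) - 1) ^ 3)) ^ Fintype.card G.edgeSet *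
          ∑ f : V → Fin k, ∑ g : V → Fin k,
            (1 + 1 / ((k : ℝ) - 1)) ^ #(edgesIn G (agreeSet f g)) := by
  have hexp : ∀ σ : G.edgeSet → Equiv.Perm (Fin k), (#{f | IsProper σ f} : ℝ) ^ 2 =
      ∑ f, ∑ g, if IsProper σ f ∧ IsProper σ g then (1 : ℝ) else 0 := by
    intro σ
    rw [sq, card_filter]
    push_cast
    rw [sum_mul_sum]
    refine sum_congr rfl fun f _ => sum_congr rfl fun g _ => ?_
    by_cases h : IsProper σ f <;> by_cases h' : IsProper σ g <;> simp [h, h']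
  simp only [hexp]
  rw [sum_comm, mul_sum]
  refine sum_le_sum fun f _ => ?_
  rw [sum_comm, mul_sum]
  refine sum_le_sum fun g _ => ?_
  rw [sum_boole]
  have h : #{σ : G.edgeSet → Equiv.Perm (Fin k) | IsProper σ f ∧ IsProper σ g} =
      ∏ e : G.edgeSet, #{π : Equiv.Perm (Fin k) |
        π (f e.1.inf) ≠ f e.1.sup ∧ π (g e.1.inf) ≠ g e.1.sup} := by
    rw [← Fintype.card_piFinset]
    congr 1
    ext σ
    simp [IsProper, forall_and]
  rw [h, Nat.cast_prod]
  refine (prod_le_prod (fun _ _ => Nat.cast_nonneg _) fun e _ =>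
    card_perm_apply_ne_apply_ne_le (by simpa using hk) (f e.1.inf) (f e.1.sup) (g e.1.inf)
      (g e.1.sup)).trans ?_
  simp only [Fintype.card_fin]
  rw [prod_mul_distrib, prod_ite, prod_const, prod_const_one, mul_one, prod_const]
  have hE : ({e : G.edgeSet | f e.1.inf = g e.1.inf ∧ f e.1.sup = g e.1.sup} : Finset _) =
      edgesIn G (agreeSet f g) := by
    ext e
    simp [edgesIn, agreeSet]
  rw [hE]
  simp only [card_univ, Fintype.card_fun, Fintype.card_perm, Fintype.card_fin, Nat.cast_pow,
    mul_pow]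
  exact le_of_eq (by ring)

theorem card_edgesIn_le_sq (S : Finset V) : (#(edgesIn G S) : ℝ) ≤ (#S : ℝ) ^ 2 / 2 := by
  classical
  have h1 : #(edgesIn G S) ≤ #(S.offDiag.image fun p => s(p.1, p.2)) := by
    refine card_le_card_of_injOn (fun e => e.1) ?_ Subtype.val_injective.injOn
    rintro ⟨e, he⟩ h
    induction e with | _ a b
    have hab : a ≠ b := G.ne_of_adj he
    simp only [edgesIn, coe_filter, mem_univ, true_and, Set.mem_ofPred_eq, Sym2.inf_mk,
      Sym2.sup_mk] at h
    simp only [coe_image, Set.mem_image, mem_coe, mem_offDiag, Prod.exists]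
    refine ⟨a, b, ?_, rfl⟩
    rcases le_total a b with hle | hle
    · rw [inf_eq_left.2 hle, sup_eq_right.2 hle] at h
      exact ⟨h.1, h.2, hab⟩
    · rw [inf_eq_right.2 hle, sup_eq_left.2 hle] at h
      exact ⟨h.2, h.1, hab⟩
  have h2 := Sym2.two_mul_card_image_offDiag S
  have h3 : #S.offDiag ≤ #S * #S := by rw [offDiag_card]; exact Nat.sub_le _ _
  have h4 : 2 * #(edgesIn G S) ≤ #S * #S := (Nat.mul_le_mul_left 2 h1).trans (h2.le.trans h3)
  rify at h4
  linarith

theorem card_edgesIn_le_maxDensity_mul (S : Finset V) :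
    (#(edgesIn G S) : ℝ) ≤ maxDensity G * #S := by
  classical
  rcases S.eq_empty_or_nonempty with rfl | hS
  · simp [edgesIn]
  have : Nonempty V := ⟨hS.choose⟩
  have h := (isGreatest_maxDensity G).2 ⟨(⊤ : G.Subgraph).induce S, by simpa using hS, rfl⟩
  have hpos : (0 : ℝ) < #S := by exact_mod_cast hS.card_pos
  unfold density at h
  rw [SimpleGraph.Subgraph.induce_verts, Set.ncard_coe_finset, div_le_iff₀ hpos] at h
  refine le_trans (Nat.cast_le.2 ?_) h
  rw [← Set.ncard_coe_finset]
  refine Set.ncard_le_ncard_of_injOn (fun e => e.1) ?_ Subtype.val_injective.injOn (Set.toFinite _)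
  rintro ⟨e, he⟩ h
  induction e with | _ a b
  have hab : G.Adj a b := he
  simp only [edgesIn, coe_filter, mem_univ, true_and, Set.mem_ofPred_eq, Sym2.inf_mk,
      Sym2.sup_mk] at h
  simp only [SimpleGraph.Subgraph.mem_edgeSet, SimpleGraph.Subgraph.induce_adj,
    SimpleGraph.Subgraph.top_adj, mem_coe, hab, and_true]
  rcases le_total a b with hle | hle
  · rw [inf_eq_left.2 hle, sup_eq_right.2 hle] at h
    exact h
  · rw [inf_eq_right.2 hle, sup_eq_left.2 hle] at h
    exact h.symm

open Classical in
theorem card_edgeSet_le_maxDensity_mul (G : SimpleGraph V) :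
    (Fintype.card G.edgeSet : ℝ) ≤ maxDensity G * Fintype.card V := by
  have h := card_edgesIn_le_maxDensity_mul (G := G) univ
  have : edgesIn G univ = univ := by simp [edgesIn]
  rw [this, card_univ, card_univ] at h
  exact h

/-! ### The union bound over large agreement sets -/

/-- For fixed `f`, there are `k ^ (n - |T|)` colorings that agree with `f` on `T`. -/
theorem card_subset_agreeSet (f : V → Fin k) (T : Finset V) :
    #{g : V → Fin k | T ⊆ agreeSet f g} = k ^ (Fintype.card V - #T) := by
  have : ({g : V → Fin k | T ⊆ agreeSet f g} : Finset _) =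
      Fintype.piFinset fun v => if v ∈ T then {f v} else univ := by
    ext g
    simp only [mem_filter, mem_univ, true_and, Fintype.mem_piFinset, subset_iff, agreeSet]
    refine forall_congr' fun v => ?_
    by_cases hv : v ∈ T <;> simp [hv, eq_comm]
  rw [this, Fintype.card_piFinset]
  have : ∀ v, #(if v ∈ T then {f v} else (univ : Finset (Fin k))) = if v ∈ T then 1 else k := by
    intro v
    split_ifs <;> simp
  simp only [this, prod_ite, prod_const_one, one_mul, prod_const]
  rw [filter_not, card_sdiff_of_subset (filter_subset _ _), card_univ]
  simp

/-- If the contribution `w` of an agreement set is at most `A` on sets of size at most `x₀` and at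
most `B i` on larger sets of size `i`, the total over all pairs of colorings is controlled by a
union bound over the large agreement sets. -/
theorem sum_agreeSet_le (hk : 0 < k) (w : Finset V → ℝ) {A x₀ : ℝ} (B : ℕ → ℝ) (hA : 0 ≤ A)
    (hB : ∀ i, 0 ≤ B i)
    (hsmall : ∀ S : Finset V, (#S : ℝ) ≤ x₀ → w S ≤ A)
    (hlarge : ∀ S : Finset V, x₀ < (#S : ℝ) → w S ≤ B #S) :
    ∑ f : V → Fin k, ∑ g : V → Fin k, w (agreeSet f g) ≤
      ((k : ℝ) ^ Fintype.card V) ^ 2 *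
        (A + ∑ i ∈ range (Fintype.card V + 1) with x₀ < ((i : ℕ) : ℝ),
          (Fintype.card V).choose i / (k : ℝ) ^ i * B i) := by
  have hk' : (0 : ℝ) < k := by exact_mod_cast hk
  set n := Fintype.card V
  have hpt : ∀ f g : V → Fin k, w (agreeSet f g) ≤
      A + ∑ T : Finset V with x₀ < (#T : ℝ), if T ⊆ agreeSet f g then B #T else 0 := by
    intro f g
    rcases le_or_gt (#(agreeSet f g) : ℝ) x₀ with h | h
    · refine (hsmall _ h).trans (le_add_of_nonneg_right (sum_nonneg fun T _ => ?_))
      split_ifs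
      exacts [hB _, le_rfl]
    · refine (hlarge _ h).trans (le_add_of_nonneg_of_le hA ?_)
      refine le_trans (le_of_eq ?_) (single_le_sum (f := fun T : Finset V =>
        if T ⊆ agreeSet f g then B #T else 0) (fun T _ => ?_)
        (mem_filter.2 ⟨mem_univ (agreeSet f g), h⟩))
      · simp
      · split_ifs
        exacts [hB _, le_rfl]
  have hrow : ∀ f : V → Fin k, ∑ g : V → Fin k, w (agreeSet f g) ≤
      (k : ℝ) ^ n * (A + ∑ i ∈ range (n + 1) with x₀ < ((i : ℕ) : ℝ),
        n.choose i / (k : ℝ) ^ i * B i) := by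
    intro f
    refine (sum_le_sum fun g _ => hpt f g).trans ?_
    rw [sum_add_distrib, sum_const, card_univ, Fintype.card_fun, Fintype.card_fin, nsmul_eq_mul,
      mul_add, sum_comm]
    push_cast
    refine add_le_add le_rfl ?_
    have hT : ∀ T : Finset V, (∑ g : V → Fin k, if T ⊆ agreeSet f g then B #T else 0) =
        (k : ℝ) ^ n / (k : ℝ) ^ #T * B #T := by
      intro T
      rw [← sum_filter, sum_const, card_subset_agreeSet, nsmul_eq_mul, Nat.cast_pow,
        pow_sub₀ _ hk'.ne' (card_le_univ T), div_eq_mul_inv]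
    simp only [hT]
    rw [← powerset_univ, sum_filter, sum_powerset, mul_sum, sum_filter]
    refine le_of_eq (sum_congr (by simp [n]) fun i hi => ?_)
    rw [sum_congr rfl (g := fun _ => if x₀ < (i : ℝ) then
      (k : ℝ) ^ n / (k : ℝ) ^ i * B i else 0), sum_const, card_powersetCard, card_univ]
    · split_ifs
      · rw [nsmul_eq_mul]
        ring
      · simp
    · intro T hT
      rw [(mem_powersetCard.1 hT).2]
  refine (sum_le_sum fun f _ => hrow f).trans (le_of_eq ?_)
  rw [sum_const, card_univ, Fintype.card_fun, Fintype.card_fin, nsmul_eq_mul]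
  push_cast
  ring

/-! ### Asymptotic estimates -/

open Filter Real

theorem eventually_log_le_mul_rpow {κ γ : ℝ} (hκ : 0 < κ) (hγ : 0 < γ) :
    ∀ᶠ x : ℝ in atTop, log x ≤ κ * x ^ γ := by
  filter_upwards [(isLittleO_log_rpow_atTop hγ).bound hκ, eventually_ge_atTop 1] with x hx hx1
  rw [norm_of_nonneg (log_nonneg hx1), norm_of_nonneg (by positivity)] at hx
  exact hx

/-- The asymptotic estimates behind the second moment bound: `a` stands for `(1 - 2s) / (1 - s)`,
so that `n ≤ ρ ^ (2 - a)`, and `ρ ^ (3 / 4 - a / 2)` is the size separating small from large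
agreement sets. Its exponent is chosen in the interval `(1 - a, 1 / 2)`, which is nonempty because
`s < 1 / 3`: the upper bound makes small sets harmless, the lower bound makes those just above the
threshold rare. -/
theorem eventually_moment_estimates {a ε η : ℝ} (ha : 1 / 2 < a) (ha1 : a ≤ 1) (hε : 0 < ε)
    (hη : 0 < η) :
    ∀ᶠ ρ : ℝ in atTop, ∀ n k : ℝ, 0 ≤ n → n ≤ ρ ^ (2 - a) → (1 + ε) / a * (ρ / log ρ) ≤ k →
      0 < ρ ∧ 1 < k ∧ ρ * n / (k - 1) ^ 3 ≤ η ∧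
      (ρ ^ (3 / 4 - a / 2)) ^ 2 / 2 / (k - 1) ≤ η ∧
      ∀ x : ℝ, ρ ^ (3 / 4 - a / 2) ≤ x →
        exp 1 * n / (x * k) * exp (min ρ (x / 2) / (k - 1)) ≤ η := by
  have ha0 : 0 < a := by linarith
  set b : ℝ := 3 / 4 - a / 2 with hb
  have hκ : 0 < min 1 η := lt_min one_pos hη
  have hgap : 0 < a - a / (1 + ε / 2) := by
    rw [sub_pos, div_lt_iff₀ (by linarith)]
    nlinarith
  filter_upwards [eventually_ge_atTop (exp 1),
    eventually_log_le_mul_rpow (κ := ε / (2 * a)) (by positivity) one_pos,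
    eventually_log_le_mul_rpow hκ (show 0 < a / 3 by linarith),
    eventually_log_le_mul_rpow (κ := 2 * η) (by positivity) (show 0 < 1 - 2 * b by linarith),
    eventually_log_le_mul_rpow two_pos (show 0 < 1 - b by linarith),
    eventually_log_le_mul_rpow (κ := η / (exp 1 * exp 1)) (by positivity)
      (show 0 < b + a - 1 by linarith),
    eventually_log_le_mul_rpow (κ := 2 * η / exp 1) (by positivity) hgap]
    with ρ hρe h1 h2 h3 h4 h5 h6 n k hn hnρ hk
  have hρ : 0 < ρ := (exp_pos 1).trans_le hρe
  have hL1 : 1 ≤ log ρ := (le_log_iff_exp_le hρ).2 hρe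
  set L := log ρ with hL
  have hL0 : 0 < L := by linarith
  have hρ1 : 1 < ρ := by linarith [add_one_lt_exp (one_ne_zero (α := ℝ))]
  rw [rpow_one] at h1
  -- replacing `k` by `k - 1` costs half of `ε`
  have hk1 : (1 + ε / 2) / a * (ρ / L) ≤ k - 1 := by
    have h : 1 ≤ ε / (2 * a) * (ρ / L) := by
      rw [← mul_div_assoc, le_div_iff₀ hL0, one_mul]
      exact h1
    have e : (1 + ε) / a * (ρ / L) = (1 + ε / 2) / a * (ρ / L) + ε / (2 * a) * (ρ / L) := by
      field_simp
      ring
    linarith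
  have hK0 : 0 < (1 + ε / 2) / a * (ρ / L) := by positivity
  have hkpos : 0 < k - 1 := hK0.trans_le hk1
  have ht1 : (k - 1)⁻¹ ≤ a / (1 + ε / 2) * (L / ρ) := by
    refine (inv_anti₀ hK0 hk1).trans (le_of_eq ?_)
    field_simp
  have ht2 : (k - 1)⁻¹ ≤ L / ρ := by
    refine ht1.trans (mul_le_of_le_one_left (by positivity) ?_)
    rw [div_le_one (by positivity)]
    linarith
  have ht0 : 0 < (k - 1)⁻¹ := inv_pos.2 hkpos
  have hkt : k⁻¹ ≤ (k - 1)⁻¹ := inv_anti₀ hkpos (by linarith)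
  have hk0 : 0 < k := by linarith
  set t := (k - 1)⁻¹ with ht
  refine ⟨hρ, by linarith, ?_, ?_, ?_⟩
  · calc ρ * n / (k - 1) ^ 3 = ρ * n * t ^ 3 := by rw [ht, inv_pow]; rfl
      _ ≤ ρ * ρ ^ (2 - a) * (L / ρ) ^ 3 := by gcongr
      _ = L ^ 3 * ρ ^ (-a) := by
        rw [show (2 : ℝ) - a = (2 : ℕ) + (-a) by push_cast; ring, rpow_add hρ, rpow_natCast]
        field_simp
      _ ≤ (min 1 η * ρ ^ (a / 3)) ^ 3 * ρ ^ (-a) := by gcongr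
      _ = (min 1 η) ^ 3 := by
        rw [mul_pow, ← rpow_natCast (ρ ^ (a / 3)), ← rpow_mul hρ.le, mul_assoc, ← rpow_add hρ]
        norm_num
      _ ≤ min 1 η := pow_le_of_le_one hκ.le (min_le_left _ _) (by norm_num)
      _ ≤ η := min_le_right _ _
  · calc (ρ ^ b) ^ 2 / 2 / (k - 1) = (ρ ^ b) ^ 2 / 2 * t := rfl
      _ ≤ (ρ ^ b) ^ 2 / 2 * (L / ρ) := by gcongr
      _ ≤ (ρ ^ b) ^ 2 / 2 * (2 * η * ρ ^ (1 - 2 * b) / ρ) := by gcongr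
      _ = η * (ρ ^ (2 * b + (1 - 2 * b)) / ρ) := by
        rw [rpow_add hρ, ← rpow_natCast, ← rpow_mul hρ.le]
        push_cast
        rw [mul_comm b 2]
        ring
      _ = η := by
        rw [add_sub_cancel, rpow_one, div_self hρ.ne', mul_one]
  · set A := exp 1 * n / k with hA
    have hA0 : 0 ≤ A := by positivity
    have hAle : A ≤ exp 1 * (ρ ^ (1 - a) * L) := by
      calc A = exp 1 * n * k⁻¹ := rfl
        _ ≤ exp 1 * ρ ^ (2 - a) * (L / ρ) := by gcongr; exact hkt.trans ht2
        _ = exp 1 * (ρ ^ (1 - a) * L) := by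
          rw [show (2 : ℝ) - a = 1 + (1 - a) by ring, rpow_add hρ, rpow_one]
          field_simp
    have hend : A * exp (ρ * t) ≤ η * (2 * ρ) := by
      have hexp : exp (ρ * t) ≤ ρ ^ (a / (1 + ε / 2)) := by
        rw [rpow_def_of_pos hρ, ← hL, exp_le_exp]
        calc ρ * t ≤ ρ * (a / (1 + ε / 2) * (L / ρ)) := by gcongr
          _ = L * (a / (1 + ε / 2)) := by field_simp
      calc A * exp (ρ * t) ≤ exp 1 * (ρ ^ (1 - a) * L) * ρ ^ (a / (1 + ε / 2)) := by gcongr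
        _ ≤ exp 1 * (ρ ^ (1 - a) * (2 * η / exp 1 * ρ ^ (a - a / (1 + ε / 2)))) *
              ρ ^ (a / (1 + ε / 2)) := by gcongr
        _ = 2 * η * ρ ^ (1 - a + (a - a / (1 + ε / 2)) + a / (1 + ε / 2)) := by
          rw [rpow_add hρ, rpow_add hρ]
          field_simp
        _ = η * (2 * ρ) := by
          rw [show 1 - a + (a - a / (1 + ε / 2)) + a / (1 + ε / 2) = 1 by ring, rpow_one]
          ring
    have hstart : A * exp (ρ ^ b / 2 * t) ≤ η * ρ ^ b := by
      have hexp : exp (ρ ^ b / 2 * t) ≤ exp 1 := by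
        rw [exp_le_exp]
        calc ρ ^ b / 2 * t ≤ ρ ^ b / 2 * (2 * ρ ^ (1 - b) / ρ) := by
              gcongr
              exact ht2.trans (by gcongr)
          _ = ρ ^ (b + (1 - b)) / ρ := by rw [rpow_add hρ]; ring
          _ = 1 := by rw [add_sub_cancel, rpow_one, div_self hρ.ne']
      calc A * exp (ρ ^ b / 2 * t) ≤ exp 1 * (ρ ^ (1 - a) * L) * exp 1 := by gcongr
        _ ≤ exp 1 * (ρ ^ (1 - a) * (η / (exp 1 * exp 1) * ρ ^ (b + a - 1))) * exp 1 := by gcongr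
        _ = η * ρ ^ (1 - a + (b + a - 1)) := by
          rw [rpow_add hρ]
          field_simp
        _ = η * ρ ^ b := by ring_nf
    intro x hx
    have hx0 : 0 < x := (rpow_pos_of_pos hρ b).trans_le hx
    have key : A * exp (min ρ (x / 2) * t) ≤ η * x := by
      rcases le_total (2 * ρ) x with h | h
      · rw [min_eq_left (by linarith)]
        exact hend.trans (by gcongr)
      · rw [min_eq_right (by linarith)]
        -- the difference of the two sides is convex in `x`, so only the endpoints matter
        have hconv : ConvexOn ℝ Set.univ fun y : ℝ => A * exp (y / 2 * t) - η * y := by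
          have he : ConvexOn ℝ Set.univ fun y : ℝ => exp (y / 2 * t) := by
            have := convexOn_exp.comp_linearMap (LinearMap.mul ℝ ℝ (t / 2))
            refine this.congr fun y _ => ?_
            simp only [Function.comp_apply, LinearMap.mul_apply']
            ring_nf
          have hl : ConcaveOn ℝ Set.univ fun y : ℝ => η * y :=
            (concaveOn_id convex_univ).smul hη.le
          exact (he.smul hA0).sub hl
        have hmax := hconv.le_max_of_mem_Icc (Set.mem_univ (ρ ^ b)) (Set.mem_univ (2 * ρ)) ⟨hx, h⟩
        have h2ρ : 2 * ρ / 2 * t = ρ * t := by ring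
        rw [h2ρ] at hmax
        have := hmax.trans (max_le (sub_nonpos.2 hstart) (sub_nonpos.2 hend))
        linarith
    calc exp 1 * n / (x * k) * exp (min ρ (x / 2) / (k - 1))
        = A * exp (min ρ (x / 2) * t) / x := by
          rw [hA, ht, ← div_eq_mul_inv (min ρ (x / 2))]
          field_simp
      _ ≤ η := by
        rw [div_le_iff₀ hx0]
        exact key

/-- The standard bound `choose n i ≤ (e n / i) ^ i`, divided by `k ^ i`. -/
theorem choose_div_pow_le {n i : ℕ} {k : ℝ} (hi : 0 < i) (hk : 0 < k) :
    (n.choose i : ℝ) / k ^ i ≤ (exp 1 * n / (i * k)) ^ i := by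
  have h1 : (n.choose i : ℝ) ≤ (n : ℝ) ^ i / (i.factorial : ℝ) := Nat.choose_le_pow_div i n
  have h2 := pow_div_factorial_le_exp (x := i) (Nat.cast_nonneg i) i
  have hi' : (0 : ℝ) < i := by exact_mod_cast hi
  have hf : (0 : ℝ) < i.factorial := by positivity
  rw [div_le_iff₀ hf] at h2
  have e : (exp 1 * n / (i * k)) ^ i = exp i * n ^ i / i ^ i / k ^ i := by
    rw [div_pow, mul_pow, mul_pow, ← exp_nat_mul, mul_one, div_div]
  rw [e]
  gcongr
  refine h1.trans ?_
  rw [div_le_div_iff₀ hf (by positivity)]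
  calc (n : ℝ) ^ i * i ^ i ≤ n ^ i * (exp i * i.factorial) := by gcongr
    _ = exp i * n ^ i * i.factorial := by ring

theorem sum_pow_le_two_mul {η x₀ : ℝ} (hη : 0 < η) (hη' : η ≤ 1 / 2) (hx₀ : 0 < x₀) (N : ℕ) :
    ∑ i ∈ range N with x₀ < ((i : ℕ) : ℝ), η ^ i ≤ 2 * η := by
  have hle : ∑ i ∈ range N with x₀ < ((i : ℕ) : ℝ), η ^ i ≤ ∑ i ∈ Ico 1 (N + 1), η ^ i := by
    refine sum_le_sum_of_subset_of_nonneg (fun i hi => ?_) fun _ _ _ => by positivity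
    rw [mem_filter, mem_range] at hi
    have : 0 < i := by exact_mod_cast hx₀.trans hi.2
    rw [mem_Ico]
    omega
  refine hle.trans ((geom_sum_Ico_le_of_lt_one hη.le (by linarith)).trans ?_)
  rw [pow_one, div_le_iff₀ (by linarith)]
  nlinarith

/-- The second moment of the number of independent transversals is close to its squared mean, given
the numerical estimates of `eventually_moment_estimates`. -/
theorem inv_exp_mul_le_colorableProb {V : Type*} [LinearOrder V] [Fintype V] {G : SimpleGraph V}
    {k : ℕ} {η x₀ : ℝ} (hη : 0 < η) (hη' : η ≤ 1 / 2) (hk : 1 < k) (hx₀ : 0 < x₀)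
    (hedges : maxDensity G * Fintype.card V / ((k : ℝ) - 1) ^ 3 ≤ η)
    (hsmall : x₀ ^ 2 / 2 / ((k : ℝ) - 1) ≤ η)
    (hlarge : ∀ x : ℝ, x₀ ≤ x → exp 1 * Fintype.card V / (x * k) *
      exp (min (maxDensity G) (x / 2) / ((k : ℝ) - 1)) ≤ η) :
    (exp η * (exp η + 2 * η))⁻¹ ≤ colorableProb G k := by
  classical
  have hk1 : (1 : ℝ) < k := by exact_mod_cast hk
  have hk' : 0 < (k : ℝ) - 1 := by linarith
  have hk0 : (0 : ℝ) < k := by linarith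
  have hq : 0 < 1 - 1 / (k : ℝ) := by
    rw [sub_pos, div_lt_one hk0]
    exact hk1
  set n := Fintype.card V
  set m := Fintype.card G.edgeSet with hm
  set B : ℕ → ℝ := fun i => exp (min (maxDensity G) ((i : ℝ) / 2) / ((k : ℝ) - 1)) ^ i
  have hw : ∀ S : Finset V, (1 + 1 / ((k : ℝ) - 1)) ^ #(edgesIn G S) ≤
      exp (#(edgesIn G S) / ((k : ℝ) - 1)) := by
    intro S
    rw [div_eq_mul_one_div (#(edgesIn G S) : ℝ), exp_nat_mul]
    gcongr
    rw [add_comm]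
    exact add_one_le_exp _
  have hpairs := sum_agreeSet_le (V := V) (k := k) (by omega)
    (fun S => (1 + 1 / ((k : ℝ) - 1)) ^ #(edgesIn G S)) (A := exp η) (x₀ := x₀) B
    (exp_pos η).le (fun i => by positivity)
    (fun S hS => by
      refine (hw S).trans (exp_le_exp.2 (le_trans ?_ hsmall))
      have := card_edgesIn_le_sq (G := G) S
      gcongr
      exact this.trans (by gcongr))
    (fun S _ => by
      refine (hw S).trans ?_
      simp only [B]
      rw [← exp_nat_mul, exp_le_exp, ← mul_div_assoc]
      gcongr
      rw [mul_min_of_nonneg _ _ (Nat.cast_nonneg _)]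
      refine le_min ((card_edgesIn_le_maxDensity_mul S).trans_eq (mul_comm _ _))
        ((card_edgesIn_le_sq S).trans_eq (by ring)))
  have htail : ∑ i ∈ range (n + 1) with x₀ < ((i : ℕ) : ℝ), (n.choose i : ℝ) / (k : ℝ) ^ i * B i ≤
      2 * η := by
    refine (sum_le_sum fun i hi => ?_).trans (sum_pow_le_two_mul hη hη' hx₀ (n + 1))
    have hi' := (mem_filter.1 hi).2
    have hi0 : 0 < i := by exact_mod_cast hx₀.trans hi'
    calc (n.choose i : ℝ) / (k : ℝ) ^ i * B i
        ≤ (exp 1 * n / (i * k)) ^ i * B i := by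
          gcongr
          exact choose_div_pow_le hi0 hk0
      _ = (exp 1 * n / (i * k) *
            exp (min (maxDensity G) ((i : ℝ) / 2) / ((k : ℝ) - 1))) ^ i := (mul_pow _ _ _).symm
      _ ≤ η ^ i := by
        gcongr
        exact hlarge i hi'.le
  have hcorr : (1 + 1 / ((k : ℝ) - 1) ^ 3) ^ m ≤ exp η := by
    calc (1 + 1 / ((k : ℝ) - 1) ^ 3) ^ m ≤ exp (1 / ((k : ℝ) - 1) ^ 3) ^ m := by
          gcongr
          rw [add_comm]
          exact add_one_le_exp _
      _ = exp (m / ((k : ℝ) - 1) ^ 3) := by rw [← exp_nat_mul, mul_one_div]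
      _ ≤ exp η := by
        refine exp_le_exp.2 (le_trans ?_ hedges)
        gcongr
        exact card_edgeSet_le_maxDensity_mul G
  refine inv_le_colorableProb (μ := (k : ℝ) ^ n * (1 - 1 / (k : ℝ)) ^ m) (by positivity)
    (by positivity) sum_card_isProper ((sum_card_isProper_sq_le hk).trans ?_)
  rw [mul_assoc]
  refine mul_le_mul_of_nonneg_left ?_ (Nat.cast_nonneg _)
  rw [← hm, mul_pow ((1 - 1 / (k : ℝ)) ^ 2)]
  calc ((1 - 1 / (k : ℝ)) ^ 2) ^ m * (1 + 1 / ((k : ℝ) - 1) ^ 3) ^ m *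
        ∑ f : V → Fin k, ∑ g : V → Fin k, (1 + 1 / ((k : ℝ) - 1)) ^ #(edgesIn G (agreeSet f g))
      ≤ ((1 - 1 / (k : ℝ)) ^ 2) ^ m * exp η * (((k : ℝ) ^ n) ^ 2 * (exp η + 2 * η)) := by
        gcongr
        exact hpairs.trans (by gcongr)
    _ = exp η * (exp η + 2 * η) * ((k : ℝ) ^ n * (1 - 1 / (k : ℝ)) ^ m) ^ 2 := by
      generalize 1 - 1 / (k : ℝ) = q
      ring

theorem exists_exp_mul_le_one_add {ε : ℝ} (hε : 0 < ε) :
    ∃ η : ℝ, 0 < η ∧ η ≤ 1 / 2 ∧ exp η * (exp η + 2 * η) ≤ 1 + ε := by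
  have hcont : Continuous fun η : ℝ => exp η * (exp η + 2 * η) := by fun_prop
  have h0 : ∀ᶠ η in nhds (0 : ℝ), exp η * (exp η + 2 * η) < 1 + ε := by
    refine hcont.continuousAt.eventually_lt_const ?_
    simpa using hε
  obtain ⟨δ, hδ, h⟩ := Metric.eventually_nhds_iff.1 h0
  refine ⟨min (δ / 2) (1 / 2), by positivity, min_le_right _ _, (h ?_).le⟩
  rw [dist_zero_right, norm_of_nonneg (by positivity)]
  exact (min_le_left _ _).trans_lt (by linarith)

end DPColoring

theorem theorem1p2 (ε : ℝ) (hε : 0 < ε) (s : ℝ) (hs₀ : 0 ≤ s) (hs₁ : s < 1 / 3) :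
    ∃ n₀ : ℕ, ∀ (V : Type*) [Fintype V] [LinearOrder V] (G : SimpleGraph V),
      n₀ ≤ Fintype.card V →
      (Fintype.card V : ℝ) ^ (1 - s) ≤ DPColoring.maxDensity G →
      ∀ k : ℕ,
        (1 + ε) * (1 + s / (1 - 2 * s)) *
          (DPColoring.maxDensity G / Real.log (DPColoring.maxDensity G)) ≤ (k : ℝ) →
        1 - ε ≤ DPColoring.colorableProb G k := by
  obtain ⟨η, hη, hη', hηε⟩ := DPColoring.exists_exp_mul_le_one_add hε
  have h1s : 0 < 1 - s := by linarith
  have h2s : 0 < 1 - 2 * s := by linarith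
  have ha : 1 / 2 < (1 - 2 * s) / (1 - s) := by
    rw [lt_div_iff₀ h1s]
    linarith
  have ha1 : (1 - 2 * s) / (1 - s) ≤ 1 := by
    rw [div_le_one h1s]
    linarith
  obtain ⟨ρ₀, hρ₀⟩ := Filter.eventually_atTop.1
    (DPColoring.eventually_moment_estimates ha ha1 hε hη)
  obtain ⟨n₀, hn₀⟩ := Filter.eventually_atTop.1
    (((tendsto_rpow_atTop h1s).comp tendsto_natCast_atTop_atTop).eventually_ge_atTop ρ₀)
  -- `ρ ≥ n ^ (1 - s)` makes `ρ` large, so that all further estimates can be stated in terms of `ρ`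
  refine ⟨n₀, fun V _ _ G hn hρ k hk => ?_⟩
  have hnρ : (Fintype.card V : ℝ) ≤ DPColoring.maxDensity G ^ (2 - (1 - 2 * s) / (1 - s)) := by
    have e : 2 - (1 - 2 * s) / (1 - s) = (1 - s)⁻¹ := by
      field_simp
      ring
    rw [e, ← Real.rpow_inv_le_iff_of_pos (Nat.cast_nonneg _)
      (le_trans (by positivity) hρ) (inv_pos.2 h1s), inv_inv]
    exact hρ
  have hcoef : (1 + ε) * (1 + s / (1 - 2 * s)) = (1 + ε) / ((1 - 2 * s) / (1 - s)) := by
    rw [one_add_div h2s.ne', div_div_eq_mul_div, mul_div_assoc]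
    congr 2
    ring
  rw [hcoef] at hk
  obtain ⟨hρpos, hk1, hedges, hsmall, hlarge⟩ :=
    hρ₀ _ ((hn₀ _ hn).trans hρ) _ _ (Nat.cast_nonneg _) hnρ hk
  refine le_trans ?_ (DPColoring.inv_exp_mul_le_colorableProb hη hη' (by exact_mod_cast hk1)
    (Real.rpow_pos_of_pos hρpos _) hedges hsmall hlarge)
  calc 1 - ε ≤ (1 + ε)⁻¹ := by
        rw [inv_eq_one_div, le_div_iff₀ (by linarith)]
        nlinarith
    _ ≤ _ := inv_anti₀ (by positivity) hηε
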